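/- Let $\kappa$ be an uncountable strong limit cardinal. A compactological set is a set $X$ with a non-empty collection $\mathscr C$ of subsets of $X$, each $K\in\mathscr C$ carrying a compact Hausdorff topology $\tau_K$, such that (i) $\bigcup\mathscr C=X$; (ii) any two members of $\mathscr C$ lie in a common member; (iii) $\tau_{K_2}=\tau_{K_1}|_{K_2}$ whenever $K_2\subseteq K_1$ are in $\mathscr C$; (iv) every compact subset of $(K,\tau_K)$, $K\in\mathscr C$, is in $\mathscr C$. Its topology is the final topology with respect to the inclusions $(K,\tau_K)\hookrightarrow X$. A morphism $(X,\mathscr C)\to(X',\mathscr C')$ is a map $f\colon X\to X'$ such that for all $K\in\mathscr C$ one has $f(K)\in\mathscr C'$ and $f|_K\colon (K,\tau_K)\to (f(K),\tau_{f(K)})$ is continuous. Let $\mathbf{Cmp}_\kappa$ be the category of those compactological sets all of whose members $K\in\mathscr C$ satisfy $|K|<\kappa$ (here $\kappa=|V|$, for $V$ the universe of small sets, is allowed and gives all compactological sets), let $*$ be its one-point object, and let $y\colon\mathbf{Cmp}_\kappa\to\mathrm{PSh}(\mathbf{Cmp}_\kappa)$ be the Yoneda embedding into the (large) category of $\mathbf{Set}$-valued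 presheaves. A space is weak Hausdorff if every continuous map from a compact Hausdorff space to it has closed range, and compactly generated if it carries the final topology with respect to all continuous maps from compact Hausdorff spaces. Then $\mathbf{Cmp}_\kappa$ is total: $y$ has a left adjoint $L\colon \mathrm{PSh}(\mathbf{Cmp}_\kappa)\to\mathbf{Cmp}_\kappa$. Explicitly, for a presheaf $F$ equip $F(*)$ with the final topology with respect to all maps $C\to F(*)$, $x\mapsto F(x\colon *\to C)(\varphi)$, with $C\in\mathbf{Cmp}_\kappa$ and $\varphi\in F(C)$. This is a compactly generated space, and the map $\upsilon_F\colon F(*)\to y(LF)(*)\cong LF$ given by the unit of the adjunction is a quotient map which exhibits the space underlying $LF$ as the reflection $hF(*)$ of $F(*)$ into the compactly generated weak Hausdorff spaces; and the compactology of $LF$ consists exactly of the finite unions of sets of the form $\upsilon_F(\varphi(K))$, the image of $K\hookrightarrow C\xrightarrow{\varphi}F(*)\xrightarrow{\upsilon_F}LF$, with $C\in\mathbf{Cmp}_\kappa$, $\varphi\in F(C)$ and $K\in\mathscr C_C$. Consequently $\mathbf{Cmp}_\kappa$ is complete and cocomplete and has the following possibly large limits and colimits. For every possibly large category $J$ and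 functor $D\colon J\to\mathbf{Cmp}_\kappa$: 1. $D$ has a limit if and only if for every $C\in\mathbf{Cmp}_\kappa$ the cones over $D$ with vertex $C$ form a small set; 2. if for every $C\in\mathbf{Cmp}_\kappa$ the connected components of the comma category $C\downarrow D$ form a small set (that is, the colimit of $y\circ D$ is a presheaf of small sets), then $D$ has a colimit. -/

import Mathlib

open CategoryTheory Opposite Topology

universe u v w

/-- A compactology on a set `X` in the sense of Buchwalter: a non-empty collection of subsets of
`X`, each of them endowed with a compact Hausdorff topology, which covers `X`, is upwards
filtering, whose topologies are coherent, and which is stable under compact subsets. -/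
structure Compactology (X : Type u) where
  /-- The collection `𝒞` of subsets of `X`. -/
  sets : Set (Set X)
  /-- The topology `τ_K` on `K ∈ 𝒞`. -/
  top : ∀ K : Set X, K ∈ sets → TopologicalSpace K
  nonempty : sets.Nonempty
  compact : ∀ (K : Set X) (hK : K ∈ sets), @CompactSpace K (top K hK)
  t2 : ∀ (K : Set X) (hK : K ∈ sets), @T2Space K (top K hK)
  covers : ⋃₀ sets = Set.univ
  directed : ∀ K₁ ∈ sets, ∀ K₂ ∈ sets, ∃ K₃ ∈ sets, K₁ ⊆ K₃ ∧ K₂ ⊆ K₃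
  coherent : ∀ (K₁ : Set X) (h₁ : K₁ ∈ sets) (K₂ : Set X) (h₂ : K₂ ∈ sets) (h : K₂ ⊆ K₁),
    top K₂ h₂ = (top K₁ h₁).induced (Set.inclusion h)
  mem_of_isCompact : ∀ (K₁ : Set X) (h₁ : K₁ ∈ sets) (A : Set K₁),
    @IsCompact K₁ (top K₁ h₁) A → Subtype.val '' A ∈ sets

namespace Compactology

variable {X Y Z : Type u}

/-- The topology of a compactological set: the final topology with respect to the inclusions
`(K, τ_K) → X`. -/
@[reducible]
def topology (c : Compactology X) : TopologicalSpace X :=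
  ⨆ (K : Set X) (hK : K ∈ c.sets), (c.top K hK).coinduced Subtype.val

/-- The defining property of the morphisms of compactological sets. -/
structure IsMorphism (c : Compactology X) (d : Compactology Y) (f : X → Y) : Prop where
  image_mem : ∀ K ∈ c.sets, f '' K ∈ d.sets
  continuous : ∀ (K : Set X) (hK : K ∈ c.sets),
    @Continuous K (f '' K : Set Y) (c.top K hK) (d.top (f '' K) (image_mem K hK))
      (K.imageFactorization f)

lemma continuous_of_eq (d : Compactology Y) {K : Type v} (t : TopologicalSpace K) {L M : Set Y}
    (e : L = M) (hL : L ∈ d.sets) (hM : M ∈ d.sets) (g : K → L) (g' : K → M)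
    (h : ∀ x, (g x : Y) = g' x) (hg : @Continuous K L t (d.top L hL) g) :
    @Continuous K M t (d.top M hM) g' := by
  subst e
  have : g = g' := funext fun x => Subtype.ext (h x)
  exact this ▸ hg

lemma isMorphism_id (c : Compactology X) : IsMorphism c c id where
  image_mem K hK := by simpa using hK
  continuous K hK :=
    c.continuous_of_eq (c.top K hK) (Set.image_id K).symm hK _ id _ (fun _ => rfl)
      (@continuous_id K (c.top K hK))

lemma IsMorphism.comp {c : Compactology X} {d : Compactology Y} {e : Compactology Z}
    {f : X → Y} {g : Y → Z} (hg : IsMorphism d e g) (hf : IsMorphism c d f) :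
    IsMorphism c e (g ∘ f) where
  image_mem K hK := by
    rw [Set.image_comp]
    exact hg.image_mem _ (hf.image_mem K hK)
  continuous K hK :=
    e.continuous_of_eq (c.top K hK) (Set.image_comp g f K).symm
      (hg.image_mem _ (hf.image_mem K hK)) _
      ((f '' K).imageFactorization g ∘ K.imageFactorization f) _ (fun _ => rfl)
      (@Continuous.comp _ _ _ (c.top K hK) (d.top _ (hf.image_mem K hK))
        (e.top _ (hg.image_mem _ (hf.image_mem K hK))) _ _
        (hg.continuous _ (hf.image_mem K hK)) (hf.continuous K hK))

lemma empty_mem (c : Compactology X) : ∅ ∈ c.sets := by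
  obtain ⟨K, hK⟩ := c.nonempty
  simpa using c.mem_of_isCompact K hK ∅ (@isCompact_empty K (c.top K hK))

lemma singleton_mem (c : Compactology X) (x : X) : {x} ∈ c.sets := by
  obtain ⟨K, hK, hx⟩ : x ∈ ⋃₀ c.sets := c.covers ▸ Set.mem_univ x
  simpa using c.mem_of_isCompact K hK {⟨x, hx⟩} (@isCompact_singleton K (c.top K hK) _)

/-- The compactology of all compact subsets of a Hausdorff space. -/
def ofT2 (X : Type u) [TopologicalSpace X] [T2Space X] : Compactology X where
  sets := {K | IsCompact K}
  top _ _ := instTopologicalSpaceSubtype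
  nonempty := ⟨∅, isCompact_empty⟩
  compact _ hK := isCompact_iff_compactSpace.mp hK
  t2 K _ := inferInstanceAs (T2Space K)
  covers := Set.eq_univ_of_forall fun x => ⟨{x}, isCompact_singleton, rfl⟩
  directed K₁ h₁ K₂ h₂ :=
    ⟨K₁ ∪ K₂, IsCompact.union h₁ h₂, Set.subset_union_left, Set.subset_union_right⟩
  coherent K₁ _ K₂ _ h :=
    (induced_compose (tγ := ‹TopologicalSpace X›) (f := Set.inclusion h)
      (g := (Subtype.val : K₁ → X))).symm
  mem_of_isCompact _ _ _ hA := hA.image continuous_subtype_val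

lemma isMorphism_const (c : Compactology X) (x : X) :
    IsMorphism (ofT2 PUnit.{u + 1}) c (fun _ => x) where
  image_mem K _ := by
    rcases K.eq_empty_or_nonempty with rfl | hK
    · simpa using c.empty_mem
    · rw [hK.image_const]
      exact c.singleton_mem x
  continuous K _ := by
    have h : DiscreteTopology K := inferInstance
    exact @continuous_of_discreteTopology K _ h _ (c.top _ _) _

end Compactology

/-- A compactological set (an object of the category `Cmp`). -/
structure Cmp : Type (u + 1) where
  carrier : Type u
  str : Compactology carrier

namespace Cmp

instance : CoeSort Cmp.{u} (Type u) := ⟨Cmp.carrier⟩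

/-- A morphism of compactological sets. -/
@[ext]
structure Hom (C D : Cmp.{u}) : Type u where
  toFun : C → D
  isMorphism : C.str.IsMorphism D.str toFun

/-- The category `Cmp` of compactological sets. -/
instance : Category.{u} Cmp.{u} where
  Hom := Hom
  id C := ⟨id, C.str.isMorphism_id⟩
  comp f g := ⟨g.toFun ∘ f.toFun, g.isMorphism.comp f.isMorphism⟩

/-- `C` is a `κ`-compactological set: `|K| < κ` for all members `K` of the compactology.
The cardinal `κ` is taken one universe above the carriers, so that besides the cardinals of sets
in `Type u` also `κ = Cardinal.univ`, for which there is no restriction at all, is allowed. -/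
def IsSmall (κ : Cardinal.{u + 1}) : ObjectProperty Cmp.{u} :=
  fun C => ∀ K ∈ C.str.sets, Cardinal.lift.{u + 1} (Cardinal.mk K) < κ

end Cmp

/-- The category `Cmp_κ` of `κ`-compactological sets. -/
abbrev CmpK (κ : Cardinal.{u + 1}) : Type (u + 1) := (Cmp.IsSmall κ).FullSubcategory

namespace CmpK

variable {κ : Cardinal.{u + 1}}

/-- The one-point `κ`-compactological set `*`. -/
def pt (hκ : Cardinal.aleph0 < κ) : CmpK κ where
  obj := ⟨PUnit, Compactology.ofT2 PUnit⟩
  property K _ := by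
    have h : Cardinal.lift.{u + 1} (Cardinal.mk K) < Cardinal.aleph0 := by
      rw [Cardinal.lift_lt_aleph0]
      exact Cardinal.mk_lt_aleph0
    exact h.trans hκ

/-- The morphism `* → C` with value `x`. -/
def point (hκ : Cardinal.aleph0 < κ) {C : CmpK κ} (x : C.obj) : pt hκ ⟶ C :=
  ObjectProperty.homMk ⟨fun _ => x, C.obj.str.isMorphism_const x⟩

/-- The map `C → F(*)` induced by an element `φ ∈ F(C)`, i.e. by a map `よ(C) → F`. -/
def evalPt (hκ : Cardinal.aleph0 < κ) (F : (CmpK κ)ᵒᵖ ⥤ Type u) {C : CmpK κ}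
    (φ : F.obj (op C)) (x : C.obj) : F.obj (op (pt hκ)) :=
  F.map (point hκ x).op φ

/-- The final topology on `F(*)` with respect to all maps `C → F(*)` given by elements of
`F(C)`. -/
@[reducible]
def finalTopology (hκ : Cardinal.aleph0 < κ) (F : (CmpK κ)ᵒᵖ ⥤ Type u) :
    TopologicalSpace (F.obj (op (pt hκ))) :=
  ⨆ (C : CmpK κ) (φ : F.obj (op C)), C.obj.str.topology.coinduced (evalPt hκ F φ)

/-- For a morphism of presheaves `η : F → よ(C)`, the map of sets `F(*) → よ(C)(*) ≅ C`. -/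
def onPoints (hκ : Cardinal.aleph0 < κ) {F : (CmpK κ)ᵒᵖ ⥤ Type u} {C : CmpK κ}
    (η : F ⟶ yoneda.obj C) (x : F.obj (op (pt hκ))) : C.obj :=
  let p : pt hκ ⟶ C := η.app (op (pt hκ)) x
  p.hom.toFun PUnit.unit

end CmpK

/-- A topological space is weak Hausdorff if every continuous map from a compact Hausdorff space
to it has closed range. -/
def WeakHausdorff (X : Type u) [TopologicalSpace X] : Prop :=
  ∀ (S : Type u) [TopologicalSpace S] [CompactSpace S] [T2Space S] (f : S → X),
    Continuous f → IsClosed (Set.range f)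

/-- `q : X → Y` exhibits `Y` as the reflection `hX` of the compactly generated space `X` into the
compactly generated weak Hausdorff spaces; moreover `q` is a quotient map. -/
structure IsWeakHausdorffReflection {X Y : Type u} (tX : TopologicalSpace X)
    (tY : TopologicalSpace Y) (q : X → Y) : Prop where
  source_compactlyGenerated : CompactlyGeneratedSpace X
  compactlyGenerated : CompactlyGeneratedSpace Y
  weakHausdorff : WeakHausdorff Y
  isQuotientMap : IsQuotientMap q
  universal : ∀ (Z : Type u) [TopologicalSpace Z] [CompactlyGeneratedSpace Z],
    WeakHausdorff Z → ∀ g : X → Z, Continuous g →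
      ∃! g' : Y → Z, Continuous g' ∧ g' ∘ q = g

/-! A compactological set is a compactly generated weak Hausdorff space with a distinguished family
of compact subsets: members are closed and carry the subspace topology (`top_eq_induced`), and
morphisms are the continuous maps preserving members (`isMorphism_iff`).

A map from a presheaf `F` to `yoneda.obj C` is determined by its effect on points
(`eq_of_onPoints_eq`), a continuous map `F(*) → C`. Since `C` is weak Hausdorff, this map factors
through the weak Hausdorff quotient hF(*). Equip hF(*) with the finite unions of images of members
(`generate`); then the factorization preserves members (`isMorphism_lift`), and this is the
adjunction. Passing to images and finite unions keeps cardinalities below `κ`.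

The topological core is `WeakHausdorff.of_separated`: identifying the points that no map to a weak
Hausdorff space separates already yields a weak Hausdorff space, with no iteration.

Limits and colimits follow formally. The presheaf of cones is represented by its own reflection; the
reflection of the presheaf colimit of the representables is the colimit. -/

/-! ### Weak Hausdorff spaces -/

namespace WeakHausdorff

variable {X S T : Type u} [TopologicalSpace X] [TopologicalSpace S] [CompactSpace S] [T2Space S]
  [TopologicalSpace T] [CompactSpace T] [T2Space T]

lemma isClosed_singleton (hX : WeakHausdorff X) (x : X) : IsClosed ({x} : Set X) := by
  simpa using hX PUnit.{u + 1} (fun _ => x) continuous_const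

lemma isClosedMap (hX : WeakHausdorff X) {f : S → X} (hf : Continuous f) : IsClosedMap f := by
  intro A hA
  have : CompactSpace A := isCompact_iff_compactSpace.mp hA.isCompact
  simpa [Set.range_comp] using hX A (f ∘ Subtype.val) (hf.comp continuous_subtype_val)

/-- In a weak Hausdorff space, the image of a compact Hausdorff space is Hausdorff. -/
lemma t2Space_range (hX : WeakHausdorff X) {f : S → X} (hf : Continuous f) :
    T2Space (Set.range f) := by
  have hc := hX.isClosedMap hf
  refine ⟨?_⟩
  rintro ⟨_, a, rfl⟩ ⟨_, b, rfl⟩ hab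
  have hab' : f a ≠ f b := fun h => hab (Subtype.ext h)
  -- The fibres over the two points are disjoint closed subsets of the normal space `S`. As `f` is
  -- closed, the points whose whole fibre lies in `U`, respectively `V`, form open sets.
  obtain ⟨U, V, hU, hV, haU, hbV, hUV⟩ := normal_separation
    ((hX.isClosed_singleton (f a)).preimage hf) ((hX.isClosed_singleton (f b)).preimage hf)
    (Set.disjoint_left.mpr fun e h₁ h₂ => hab' (h₁.symm.trans h₂))
  refine ⟨Subtype.val ⁻¹' (f '' Uᶜ)ᶜ, Subtype.val ⁻¹' (f '' Vᶜ)ᶜ,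
    (hc _ hU.isClosed_compl).isOpen_compl.preimage continuous_subtype_val,
    (hc _ hV.isClosed_compl).isOpen_compl.preimage continuous_subtype_val, ?_, ?_, ?_⟩
  · rintro ⟨e, he, h⟩
    exact he (haU h)
  · rintro ⟨e, he, h⟩
    exact he (hbV h)
  · rw [Set.disjoint_left]
    rintro ⟨_, e, rfl⟩ h₁ h₂
    have h₁' : e ∈ U := by
      by_contra h
      exact h₁ ⟨e, h, rfl⟩
    have h₂' : e ∈ V := by
      by_contra h
      exact h₂ ⟨e, h, rfl⟩
    exact Set.disjoint_left.mp hUV h₁' h₂'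

/-- Both maps land in the image of the compact Hausdorff space `S ⊕ T`, which is Hausdorff, so the
usual closedness of coincidence sets applies. -/
lemma isClosed_setOf_eq (hX : WeakHausdorff X) {f : S → X} (hf : Continuous f) {g : T → X}
    (hg : Continuous g) : IsClosed {p : S × T | f p.1 = g p.2} := by
  have := hX.t2Space_range (hf.sumElim hg)
  let f' : S → Set.range (Sum.elim f g) := fun s => ⟨f s, Sum.inl s, rfl⟩
  let g' : T → Set.range (Sum.elim f g) := fun t => ⟨g t, Sum.inr t, rfl⟩
  have hf' : Continuous f' := hf.subtype_mk _
  have hg' : Continuous g' := hg.subtype_mk _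
  have : {p : S × T | f p.1 = g p.2} = {p | f' p.1 = g' p.2} := by
    ext p
    exact (Subtype.ext_iff (a1 := f' p.1) (a2 := g' p.2)).symm
  rw [this]
  exact isClosed_eq (hf'.comp continuous_fst) (hg'.comp continuous_snd)

/-- A compactly generated space is weak Hausdorff as soon as its points are separated by
continuous maps to weak Hausdorff spaces. -/
lemma of_separated [CompactlyGeneratedSpace X]
    (h : ∀ x y : X, (∀ (Z : Type u) [TopologicalSpace Z], WeakHausdorff Z → ∀ g : X → Z,
      Continuous g → g x = g y) → x = y) : WeakHausdorff X := by
  intro S _ _ _ f hf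
  refine CompactlyGeneratedSpace.isClosed' fun T _ _ _ g hg => ?_
  -- By separation, the coincidence set is an intersection of coincidence sets in weak Hausdorff
  -- spaces.
  have hE : IsClosed {p : S × T | f p.1 = g p.2} := by
    have : {p : S × T | f p.1 = g p.2} =
        ⋂ (Z : Type u) (_ : TopologicalSpace Z) (_ : WeakHausdorff Z) (q : X → Z)
          (_ : Continuous q), {p : S × T | (q ∘ f) p.1 = (q ∘ g) p.2} := by
      ext p
      simp only [Set.mem_ofPred_eq, Set.mem_iInter]
      exact ⟨fun e Z _ _ q _ => congrArg q e, fun H => h _ _ fun Z tZ hZ q hq => H Z tZ hZ q hq⟩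
    rw [this]
    refine isClosed_iInter fun Z => isClosed_iInter fun tZ => isClosed_iInter fun hZ =>
      isClosed_iInter fun q => isClosed_iInter fun hq => ?_
    exact hZ.isClosed_setOf_eq (hq.comp hf) (hq.comp hg)
  -- Closedness is tested along `g`; the preimage is a projection of a closed subset of a compact
  -- space.
  have : g ⁻¹' Set.range f = Prod.snd '' {p : S × T | f p.1 = g p.2} := by
    ext t
    exact ⟨fun ⟨s, hs⟩ => ⟨(s, t), hs, rfl⟩, fun ⟨⟨s, _⟩, hs, e⟩ => ⟨s, e ▸ hs⟩⟩
  rw [this]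
  exact (hE.isCompact.image continuous_snd).isClosed

end WeakHausdorff

/-! ### The weak Hausdorff reflection -/

/-- The relation identifying the points which are not separated by continuous maps to weak
Hausdorff spaces. -/
def weakHausdorffSetoid (X : Type u) [TopologicalSpace X] : Setoid X where
  r x y := ∀ (Z : Type u) [TopologicalSpace Z], WeakHausdorff Z → ∀ g : X → Z,
    Continuous g → g x = g y
  iseqv :=
    { refl := fun _ _ _ _ _ _ => rfl
      symm := fun h Z _ hZ g hg => (h Z hZ g hg).symm
      trans := fun h₁ h₂ Z _ hZ g hg => (h₁ Z hZ g hg).trans (h₂ Z hZ g hg) }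

/-- The weak Hausdorff reflection of a compactly generated space. -/
abbrev WeakHausdorffQuotient (X : Type u) [TopologicalSpace X] : Type u :=
  Quotient (weakHausdorffSetoid X)

namespace WeakHausdorffQuotient

variable {X : Type u} [TopologicalSpace X]

/-- The factorization through the reflection of a continuous map to a weak Hausdorff space. -/
def lift {Z : Type u} [TopologicalSpace Z] (hZ : WeakHausdorff Z) (g : X → Z)
    (hg : Continuous g) : WeakHausdorffQuotient X → Z :=
  Quotient.lift g fun _ _ h => h Z hZ g hg

lemma continuous_lift {Z : Type u} [TopologicalSpace Z] (hZ : WeakHausdorff Z) (g : X → Z)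
    (hg : Continuous g) : Continuous (lift hZ g hg) :=
  hg.quotient_lift _

/-- Every test map on `X` descends to the quotient, so distinct classes are still separated there.
-/
lemma weakHausdorff [CompactlyGeneratedSpace X] : WeakHausdorff (WeakHausdorffQuotient X) := by
  refine WeakHausdorff.of_separated fun x y h => ?_
  induction x using Quotient.inductionOn with | _ x
  induction y using Quotient.inductionOn with | _ y
  exact Quotient.sound fun Z _ hZ g hg => h Z hZ (lift hZ g hg) (continuous_lift hZ g hg)

lemma isWeakHausdorffReflection [CompactlyGeneratedSpace X] :
    IsWeakHausdorffReflection ‹TopologicalSpace X›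
      (inferInstanceAs (TopologicalSpace (WeakHausdorffQuotient X)))
      (Quotient.mk (weakHausdorffSetoid X)) where
  source_compactlyGenerated := inferInstance
  compactlyGenerated := inferInstanceAs (CompactlyGeneratedSpace (WeakHausdorffQuotient X))
  weakHausdorff := weakHausdorff
  isQuotientMap := isQuotientMap_quot_mk
  universal Z _ _ hZ g hg := by
    refine ⟨lift hZ g hg, ⟨continuous_lift hZ g hg, rfl⟩, fun g' h => funext fun y => ?_⟩
    induction y using Quotient.inductionOn with | _ y
    exact congrFun h.2 y

end WeakHausdorffQuotient

/-! ### Compactologies as families of compact subsets of a weak Hausdorff space -/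

namespace Compactology

variable {X Y : Type u}

lemma isClosed_topology_iff (c : Compactology X) {A : Set X} :
    IsClosed[c.topology] A ↔
      ∀ (K : Set X) (hK : K ∈ c.sets), IsClosed[c.top K hK] (Subtype.val ⁻¹' A) := by
  simp only [isClosed_iSup_iff, isClosed_coinduced]

lemma continuous_topology_iff (c : Compactology X) [t : TopologicalSpace Y] {f : X → Y} :
    Continuous[c.topology, t] f ↔
      ∀ (K : Set X) (hK : K ∈ c.sets), Continuous[c.top K hK, t] (f ∘ Subtype.val) := by
  simp only [continuous_iSup_dom, continuous_coinduced_dom]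

/-- Inside a common member `M`, which is Hausdorff, the compact `K` is closed; pull back to `L`. -/
lemma isClosed_preimage_of_mem (c : Compactology X) {K L : Set X} (hK : K ∈ c.sets)
    (hL : L ∈ c.sets) : IsClosed[c.top L hL] (Subtype.val ⁻¹' K) := by
  obtain ⟨M, hM, hKM, hLM⟩ := c.directed K hK L hL
  let := c.top M hM
  have := c.t2 M hM
  let := c.top K hK
  have := c.compact K hK
  have hi : Continuous (Set.inclusion hKM) := continuous_iff_le_induced.mpr
    (c.coherent M hM K hK hKM).le
  let := c.top L hL
  have hj : Continuous (Set.inclusion hLM) := continuous_iff_le_induced.mpr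
    (c.coherent M hM L hL hLM).le
  have h := (isCompact_range hi).isClosed.preimage hj
  have e : Set.inclusion hLM ⁻¹' Set.range (Set.inclusion hKM) = Subtype.val ⁻¹' K := by
    ext x
    rw [Set.mem_preimage, Set.range_inclusion]
    rfl
  rwa [e] at h

lemma isClosed_of_mem (c : Compactology X) {K : Set X} (hK : K ∈ c.sets) :
    IsClosed[c.topology] K :=
  c.isClosed_topology_iff.mpr fun _ hL => c.isClosed_preimage_of_mem hK hL

lemma continuous_val (c : Compactology X) {K : Set X} (hK : K ∈ c.sets) :
    Continuous[c.top K hK, c.topology] (Subtype.val : K → X) :=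
  continuous_iff_coinduced_le.mpr (le_iSup₂_of_le K hK le_rfl)

/-- A closed subset of `K` is compact, hence a member, hence closed in `X`: the inclusion is a
closed embedding. -/
lemma top_eq_induced (c : Compactology X) {K : Set X} (hK : K ∈ c.sets) :
    c.top K hK = c.topology.induced Subtype.val := by
  refine le_antisymm (continuous_iff_le_induced.mp (c.continuous_val hK)) ?_
  rw [← continuous_id_iff_le]
  refine (@continuous_iff_isClosed K K (c.topology.induced Subtype.val) (c.top K hK) id).mpr
    fun A hA => ?_
  let := c.topology
  refine isClosed_induced_iff.mpr ⟨Subtype.val '' A, c.isClosed_of_mem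
    (c.mem_of_isCompact K hK A ?_), Set.preimage_image_eq A Subtype.val_injective⟩
  let := c.top K hK
  have := c.compact K hK
  exact hA.isCompact

lemma mem_of_isClosed (c : Compactology X) {K A : Set X} (hK : K ∈ c.sets) (hAK : A ⊆ K)
    (hA : IsClosed[c.topology] A) : A ∈ c.sets := by
  let := c.top K hK
  have := c.compact K hK
  have h := c.mem_of_isCompact K hK (Subtype.val ⁻¹' A)
    (c.isClosed_topology_iff.mp hA K hK).isCompact
  rwa [Subtype.image_preimage_coe, Set.inter_eq_right.mpr hAK] at h

lemma sUnion_mem (c : Compactology X) {𝒜 : Set (Set X)} (hf : 𝒜.Finite) (h : 𝒜 ⊆ c.sets) :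
    ⋃₀ 𝒜 ∈ c.sets := by
  induction 𝒜, hf using Set.Finite.induction_on with
  | empty => simpa using c.empty_mem
  | @insert A 𝒜 _ _ ih =>
    rw [Set.insert_subset_iff] at h
    have h₂ := ih h.2
    obtain ⟨M, hM, h₁M, h₂M⟩ := c.directed A h.1 _ h₂
    rw [Set.sUnion_insert]
    let := c.topology
    exact c.mem_of_isClosed hM (Set.union_subset h₁M h₂M)
      ((c.isClosed_of_mem h.1).union (c.isClosed_of_mem h₂))

lemma image_sUnion_mem (c : Compactology X) {f : Y → X} {𝒜 : Set (Set Y)} (hf : 𝒜.Finite)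
    (h : ∀ A ∈ 𝒜, f '' A ∈ c.sets) : f '' ⋃₀ 𝒜 ∈ c.sets := by
  rw [Set.image_sUnion]
  exact c.sUnion_mem (hf.image _) (Set.image_subset_iff.mpr h)

lemma weakHausdorff (c : Compactology X) : @WeakHausdorff X c.topology := by
  let := c.topology
  intro S _ _ _ f hf
  refine c.isClosed_topology_iff.mpr fun K hK => ?_
  have := c.t2 K hK
  rw [c.top_eq_induced hK] at this ⊢
  have hc : IsCompact (f ⁻¹' K) := ((c.isClosed_of_mem hK).preimage hf).isCompact
  have h : IsCompact (Subtype.val ⁻¹' Set.range f : Set K) := by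
    rw [Topology.IsEmbedding.subtypeVal.isCompact_iff, Subtype.image_preimage_coe,
      ← Set.image_preimage_eq_inter_range]
    exact hc.image hf
  exact h.isClosed

/-- Morphisms of compactological sets are the continuous maps preserving the members. -/
lemma isMorphism_iff {c : Compactology X} {d : Compactology Y} {f : X → Y} :
    IsMorphism c d f ↔
      Continuous[c.topology, d.topology] f ∧ ∀ K ∈ c.sets, f '' K ∈ d.sets := by
  have key (K : Set X) (hK : K ∈ c.sets) (hfK : f '' K ∈ d.sets) :
      Continuous[c.top K hK, d.top _ hfK] (K.imageFactorization f) ↔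
        Continuous[c.top K hK, d.topology] (f ∘ Subtype.val) := by
    rw [d.top_eq_induced hfK, continuous_induced_rng]
    rfl
  let := d.topology
  rw [continuous_topology_iff]
  exact ⟨fun h => ⟨fun K hK => (key K hK _).mp (h.continuous K hK), h.image_mem⟩,
    fun h => ⟨h.2, fun K hK => (key K hK _).mpr (h.1 K hK)⟩⟩

/-- The compactology on a weak Hausdorff space given by the finite unions of members of a family
of images of compact Hausdorff spaces. -/
def generate [TopologicalSpace X] (hX : WeakHausdorff X) (ℬ : Set (Set X))
    (hℬ : ∀ B ∈ ℬ, ∃ (S : Type u) (_ : TopologicalSpace S) (_ : CompactSpace S) (_ : T2Space S)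
      (f : S → X), Continuous f ∧ B = Set.range f)
    (hcov : ⋃₀ ℬ = Set.univ) (hclosed : ∀ B ∈ ℬ, ∀ A, IsClosed A → A ⊆ B → A ∈ ℬ) :
    Compactology X :=
  -- A finite disjoint union of compact Hausdorff spaces is compact Hausdorff, so a finite union of
  -- images is again one image.
  have key (K : Set X) (hK : ∃ 𝒜 : Set (Set X), 𝒜.Finite ∧ K = ⋃₀ 𝒜 ∧ ∀ B ∈ 𝒜, B ∈ ℬ) :
      ∃ (S : Type u) (_ : TopologicalSpace S) (_ : CompactSpace S) (_ : T2Space S)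
        (f : S → X), Continuous f ∧ K = Set.range f := by
    obtain ⟨𝒜, h𝒜, rfl, h⟩ := hK
    have : Finite 𝒜 := h𝒜
    choose S t hc h2 f hf hB using fun B : 𝒜 => hℬ B (h B B.2)
    refine ⟨Σ B, S B, inferInstance, inferInstance, inferInstance, fun p => f p.1 p.2,
      continuous_sigma hf, ?_⟩
    rw [Set.range_sigma_eq_iUnion_range, Set.sUnion_eq_iUnion]
    exact Set.iUnion_congr hB
  { sets := {K | ∃ 𝒜 : Set (Set X), 𝒜.Finite ∧ K = ⋃₀ 𝒜 ∧ ∀ B ∈ 𝒜, B ∈ ℬ}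
    top := fun _ _ => instTopologicalSpaceSubtype
    nonempty := ⟨∅, ∅, Set.finite_empty, by simp, by simp⟩
    compact := fun K hK => by
      obtain ⟨S, _, _, _, f, hf, rfl⟩ := key K hK
      exact isCompact_iff_compactSpace.mp (isCompact_range hf)
    t2 := fun K hK => by
      obtain ⟨S, _, _, _, f, hf, rfl⟩ := key K hK
      exact hX.t2Space_range hf
    covers := by
      refine Set.eq_univ_of_forall fun x => ?_
      obtain ⟨B, hB, hx⟩ : x ∈ ⋃₀ ℬ := hcov ▸ Set.mem_univ x
      exact ⟨B, ⟨{B}, Set.finite_singleton B, by simp, by simpa using hB⟩, hx⟩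
    directed := by
      rintro _ ⟨𝒜₁, hf₁, rfl, h₁⟩ _ ⟨𝒜₂, hf₂, rfl, h₂⟩
      refine ⟨⋃₀ (𝒜₁ ∪ 𝒜₂), ⟨_, hf₁.union hf₂, rfl, ?_⟩,
        Set.sUnion_subset_sUnion Set.subset_union_left,
        Set.sUnion_subset_sUnion Set.subset_union_right⟩
      rintro B (hB | hB)
      exacts [h₁ B hB, h₂ B hB]
    coherent := fun K₁ _ K₂ _ h =>
      (induced_compose (tγ := ‹TopologicalSpace X›) (f := Set.inclusion h)
        (g := (Subtype.val : K₁ → X))).symm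
    mem_of_isCompact := fun K hK A hA => by
      have hA' : IsClosed (Subtype.val '' A) := by
        obtain ⟨S, _, _, _, f, hf, rfl⟩ := key K hK
        have := hX.t2Space_range hf
        exact (hX S f hf).isClosedEmbedding_subtypeVal.isClosedMap _ hA.isClosed
      obtain ⟨𝒜, hf, rfl, h⟩ := hK
      -- Cut the closed set along the finitely many pieces; each part is a closed subset of a member
      -- of `ℬ`.
      refine ⟨(fun B => Subtype.val '' A ∩ B) '' 𝒜, hf.image _, ?_, ?_⟩
      · rw [Set.sUnion_image, ← Set.inter_iUnion₂, ← Set.sUnion_eq_biUnion]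
        exact (Set.inter_eq_left.mpr (Subtype.coe_image_subset _ _)).symm
      · rintro _ ⟨B, hB, rfl⟩
        refine hclosed B (h B hB) _ (hA'.inter ?_) Set.inter_subset_right
        obtain ⟨S, _, _, _, f, hf, e⟩ := hℬ B (h B hB)
        exact e ▸ hX S f hf }

lemma topology_generate [t : TopologicalSpace X] (hX : WeakHausdorff X) (ℬ : Set (Set X))
    (hℬ : ∀ B ∈ ℬ, ∃ (S : Type u) (_ : TopologicalSpace S) (_ : CompactSpace S) (_ : T2Space S)
      (f : S → X), Continuous f ∧ B = Set.range f)
    (hcov : ⋃₀ ℬ = Set.univ) (hclosed : ∀ B ∈ ℬ, ∀ A, IsClosed A → A ⊆ B → A ∈ ℬ)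
    (hfinal : ∀ A : Set X, (∀ B ∈ ℬ, IsClosed (Subtype.val ⁻¹' A : Set B)) → IsClosed A) :
    (generate hX ℬ hℬ hcov hclosed).topology = t := by
  refine TopologicalSpace.ext_isClosed fun A => ?_
  rw [isClosed_topology_iff]
  exact ⟨fun h => hfinal A fun B hB => h B
      ⟨{B}, Set.finite_singleton B, by simp, by simpa using hB⟩,
    fun h K _ => h.preimage continuous_subtype_val⟩

end Compactology

/-! ### The reflection of a presheaf -/

namespace CmpK

variable {κ : Cardinal.{u + 1}} (hκ : Cardinal.aleph0 < κ)

section Presheaf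

variable (F : (CmpK κ)ᵒᵖ ⥤ Type u)

/-- The set `F(*)`, viewed as a topological space. -/
def Points : Type u := F.obj (op (pt hκ))

instance : TopologicalSpace (Points hκ F) := finalTopology hκ F

lemma isClosed_points_iff {A : Set (Points hκ F)} :
    IsClosed A ↔ ∀ (C : CmpK κ) (φ : F.obj (op C)),
      IsClosed[C.obj.str.topology] (evalPt hκ F φ ⁻¹' A) :=
  isClosed_iSup_iff.trans (forall_congr' fun _ => isClosed_iSup_iff.trans
    (forall_congr' fun _ => isClosed_coinduced))

lemma continuous_points_iff {Z : Type u} [t : TopologicalSpace Z] {f : Points hκ F → Z} :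
    Continuous f ↔ ∀ (C : CmpK κ) (φ : F.obj (op C)),
      Continuous[C.obj.str.topology, t] fun x => f (evalPt hκ F φ x) :=
  continuous_iSup_dom.trans (forall_congr' fun _ => continuous_iSup_dom.trans
    (forall_congr' fun _ => continuous_coinduced_dom))

lemma continuous_evalPt {C : CmpK κ} (φ : F.obj (op C)) :
    Continuous[C.obj.str.topology, finalTopology hκ F] (evalPt hκ F φ) :=
  continuous_iff_coinduced_le.mpr (le_iSup₂_of_le C φ le_rfl)

instance : CompactlyGeneratedSpace (Points hκ F) := by
  refine compactlyGeneratedSpace_of_isClosed fun A hA => (isClosed_points_iff hκ F).mpr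
    fun C φ => C.obj.str.isClosed_topology_iff.mpr fun K hK => ?_
  let := C.obj.str.top K hK
  have := C.obj.str.compact K hK
  have := C.obj.str.t2 K hK
  let := C.obj.str.topology
  let := finalTopology hκ F
  exact hA K (fun x => evalPt hκ F φ x)
    ((continuous_evalPt hκ F φ).comp (C.obj.str.continuous_val hK))

lemma evalPt_map {C D : CmpK κ} (f : C ⟶ D) (φ : F.obj (op D)) (x : C.obj) :
    evalPt hκ F (F.map f.op φ) x = evalPt hκ F φ (f.hom.toFun x) := by
  have : point hκ x ≫ f = point hκ (f.hom.toFun x) := rfl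
  simp only [evalPt, ← this, op_comp, Functor.map_comp, types_comp_apply]

lemma evalPt_pt (φ : F.obj (op (pt hκ))) (x : (pt hκ).obj) : evalPt hκ F φ x = φ := by
  have : point hκ x = 𝟙 (pt hκ) := rfl
  simp [evalPt, this]

variable {F}

/-- Naturality of `η` along `point hκ x`. This reduces statements about `η` to its map on points. -/
lemma onPoints_evalPt {C D : CmpK κ} (η : F ⟶ yoneda.obj C) (φ : F.obj (op D)) (x : D.obj) :
    onPoints hκ η (evalPt hκ F φ x) = (show D ⟶ C from η.app (op D) φ).hom.toFun x := by
  simp only [onPoints, evalPt, NatTrans.naturality_apply]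
  rfl

lemma continuous_onPoints {C : CmpK κ} (η : F ⟶ yoneda.obj C) :
    Continuous[finalTopology hκ F, C.obj.str.topology] (onPoints hκ η) := by
  let := C.obj.str.topology
  refine (continuous_points_iff hκ F).mpr fun D φ => ?_
  simp only [onPoints_evalPt]
  exact (Compactology.isMorphism_iff.mp
    (show D ⟶ C from η.app (op D) φ).hom.isMorphism).1

/-- The composite `C → F(*) → hF(*)` given by `φ ∈ F(C)`. -/
def toQuotient {C : CmpK κ} (φ : F.obj (op C)) (x : C.obj) :
    WeakHausdorffQuotient (Points hκ F) :=
  Quotient.mk _ (evalPt hκ F φ x)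

lemma continuous_toQuotient {C : CmpK κ} (φ : F.obj (op C)) :
    Continuous[C.obj.str.topology, inferInstance] (toQuotient hκ φ) :=
  let := C.obj.str.topology
  Continuous.comp (Y := Points hκ F) continuous_quot_mk (continuous_evalPt hκ F φ)

variable (F)

/-- The images in `hF(*)` of the members of the compactologies of the `C` mapping to `F`. -/
def basicSets : Set (Set (WeakHausdorffQuotient (Points hκ F))) :=
  {B | ∃ (C : CmpK κ) (φ : F.obj (op C)), ∃ K ∈ C.obj.str.sets, B = toQuotient hκ φ '' K}

variable {F}

lemma exists_range_of_mem_basicSets {B : Set (WeakHausdorffQuotient (Points hκ F))}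
    (hB : B ∈ basicSets hκ F) :
    ∃ (S : Type u) (_ : TopologicalSpace S) (_ : CompactSpace S) (_ : T2Space S)
      (f : S → WeakHausdorffQuotient (Points hκ F)), Continuous f ∧ B = Set.range f := by
  obtain ⟨C, φ, K, hK, rfl⟩ := hB
  let := C.obj.str.top K hK
  let := C.obj.str.topology
  refine ⟨K, C.obj.str.top K hK, C.obj.str.compact K hK, C.obj.str.t2 K hK,
    toQuotient hκ φ ∘ Subtype.val,
    (continuous_toQuotient hκ φ).comp (C.obj.str.continuous_val hK), ?_⟩
  rw [Set.range_comp, Subtype.range_coe]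

lemma sUnion_basicSets : ⋃₀ basicSets hκ F = Set.univ := by
  refine Set.eq_univ_of_forall fun y => ?_
  induction y using Quotient.inductionOn with | _ y
  -- Each element of `F(*)` is itself a map from the one-point object.
  refine ⟨_, ⟨pt hκ, y, {PUnit.unit}, (pt hκ).obj.str.singleton_mem _, rfl⟩,
    PUnit.unit, rfl, ?_⟩
  exact congrArg (Quotient.mk _) (evalPt_pt hκ F y PUnit.unit)

lemma mem_basicSets_of_isClosed {A B : Set (WeakHausdorffQuotient (Points hκ F))}
    (hB : B ∈ basicSets hκ F) (hA : IsClosed A) (hAB : A ⊆ B) : A ∈ basicSets hκ F := by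
  obtain ⟨C, φ, K, hK, rfl⟩ := hB
  let := C.obj.str.topology
  refine ⟨C, φ, K ∩ toQuotient hκ φ ⁻¹' A, C.obj.str.mem_of_isClosed hK Set.inter_subset_left
    ((C.obj.str.isClosed_of_mem hK).inter (hA.preimage (continuous_toQuotient hκ φ))), ?_⟩
  rw [Set.image_inter_preimage, Set.inter_eq_right.mpr hAB]

lemma isClosed_of_forall_basicSets {A : Set (WeakHausdorffQuotient (Points hκ F))}
    (h : ∀ B ∈ basicSets hκ F, IsClosed (Subtype.val ⁻¹' A : Set B)) : IsClosed A := by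
  refine isQuotientMap_quot_mk.isClosed_preimage.mp ((isClosed_points_iff hκ F).mpr fun C φ =>
    C.obj.str.isClosed_topology_iff.mpr fun K hK => ?_)
  let := C.obj.str.top K hK
  let := C.obj.str.topology
  have hc : Continuous (K.imageFactorization (toQuotient hκ φ)) :=
    continuous_induced_rng.mpr
      ((continuous_toQuotient hκ φ).comp (C.obj.str.continuous_val hK))
  exact (h _ ⟨C, φ, K, hK, rfl⟩).preimage hc

lemma mk_lt_of_mem_basicSets {B : Set (WeakHausdorffQuotient (Points hκ F))}
    (hB : B ∈ basicSets hκ F) : Cardinal.lift.{u + 1} (Cardinal.mk B) < κ := by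
  obtain ⟨C, φ, K, hK, rfl⟩ := hB
  exact (Cardinal.lift_le.mpr Cardinal.mk_image_le).trans_lt (C.property K hK)

lemma mk_sUnion_lt (hκ : Cardinal.aleph0 < κ) {X : Type u} {𝒜 : Set (Set X)} (hf : 𝒜.Finite)
    (h : ∀ B ∈ 𝒜, Cardinal.lift.{u + 1} (Cardinal.mk B) < κ) :
    Cardinal.lift.{u + 1} (Cardinal.mk (⋃₀ 𝒜)) < κ := by
  induction 𝒜, hf using Set.Finite.induction_on with
  | empty => simpa using Cardinal.aleph0_pos.trans hκ
  | @insert A 𝒜 _ _ ih =>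
    rw [Set.sUnion_insert]
    refine (Cardinal.lift_le.mpr (Cardinal.mk_union_le _ _)).trans_lt ?_
    rw [Cardinal.lift_add]
    exact Cardinal.add_lt_of_lt hκ.le (h _ (Set.mem_insert _ _))
      (ih fun B hB => h B (Set.mem_insert_of_mem _ hB))

variable (F)

/-- The value at `F` of the left adjoint of the Yoneda embedding. -/
def reflection : CmpK κ where
  obj := ⟨WeakHausdorffQuotient (Points hκ F),
    .generate WeakHausdorffQuotient.weakHausdorff (basicSets hκ F)
      (fun _ => exists_range_of_mem_basicSets hκ) (sUnion_basicSets hκ)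
      (fun _ hB _ => mem_basicSets_of_isClosed hκ hB)⟩
  property := by
    rintro _ ⟨𝒜, hf, rfl, h⟩
    exact mk_sUnion_lt hκ hf fun B hB => mk_lt_of_mem_basicSets hκ (h B hB)

lemma topology_reflection :
    (reflection hκ F).obj.str.topology =
      (inferInstanceAs (TopologicalSpace (WeakHausdorffQuotient (Points hκ F)))) :=
  Compactology.topology_generate WeakHausdorffQuotient.weakHausdorff (basicSets hκ F)
    (fun _ => exists_range_of_mem_basicSets hκ) (sUnion_basicSets hκ)
    (fun _ hB _ => mem_basicSets_of_isClosed hκ hB) fun _ => isClosed_of_forall_basicSets hκ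

variable {F}

lemma isMorphism_toQuotient {C : CmpK κ} (φ : F.obj (op C)) :
    C.obj.str.IsMorphism (reflection hκ F).obj.str (toQuotient hκ φ) := by
  refine Compactology.isMorphism_iff.mpr ⟨?_, fun K hK =>
    ⟨{toQuotient hκ φ '' K}, Set.finite_singleton _, (Set.sUnion_singleton _).symm, ?_⟩⟩
  · rw [topology_reflection]
    exact continuous_toQuotient hκ φ
  · rintro _ rfl
    exact ⟨C, φ, K, hK, rfl⟩

variable (F) in
/-- The morphism from a presheaf to the presheaf represented by its reflection. -/
def reflectionUnit : F ⟶ yoneda.obj (reflection hκ F) where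
  app C := ↾fun φ => (ObjectProperty.homMk ⟨toQuotient hκ φ, isMorphism_toQuotient hκ φ⟩ :
    C.unop ⟶ reflection hκ F)
  naturality C D f := by
    ext φ
    refine ObjectProperty.hom_ext _ (Cmp.Hom.ext (funext fun x => ?_))
    exact congrArg (Quotient.mk _) (evalPt_map hκ F f.unop φ x)

variable (F) in
lemma onPoints_reflectionUnit :
    onPoints hκ (reflectionUnit hκ F) = Quotient.mk (weakHausdorffSetoid (Points hκ F)) :=
  funext fun x => congrArg (Quotient.mk _) (evalPt_pt hκ F x PUnit.unit)

lemma onPoints_comp {C D : CmpK κ} (η : F ⟶ yoneda.obj C) (f : C ⟶ D) :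
    onPoints hκ (η ≫ yoneda.map f) = f.hom.toFun ∘ onPoints hκ η := rfl

lemma eq_of_onPoints_eq {C : CmpK κ} {η θ : F ⟶ yoneda.obj C}
    (h : onPoints hκ η = onPoints hκ θ) : η = θ := by
  ext D φ
  refine ObjectProperty.hom_ext _ (Cmp.Hom.ext (funext fun x => ?_))
  exact (onPoints_evalPt hκ η φ x).symm.trans
    ((congrFun h _).trans (onPoints_evalPt hκ θ φ x))

lemma isMorphism_lift {C : CmpK κ} (η : F ⟶ yoneda.obj C) :
    (reflection hκ F).obj.str.IsMorphism C.obj.str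
      (@WeakHausdorffQuotient.lift (Points hκ F) _ _ C.obj.str.topology C.obj.str.weakHausdorff
        (onPoints hκ η) (continuous_onPoints hκ η)) := by
  let := C.obj.str.topology
  refine Compactology.isMorphism_iff.mpr ⟨?_, ?_⟩
  · rw [topology_reflection]
    exact WeakHausdorffQuotient.continuous_lift _ _ _
  · rintro _ ⟨𝒜, hf, rfl, h⟩
    refine C.obj.str.image_sUnion_mem hf fun B hB => ?_
    obtain ⟨D, φ, K, hK, rfl⟩ := h B hB
    -- The basic set coming from `φ` and `K` is sent to the image of `K` under the morphism `η(φ)`.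
    exact Set.mem_of_eq_of_mem ((Set.image_image _ _ _).trans
      (Set.image_congr fun x _ => onPoints_evalPt hκ η φ x))
      ((show D ⟶ C from η.app (op D) φ).hom.isMorphism.image_mem K hK)

/-- The universal property of the reflection. -/
def reflectionHomEquiv (F : (CmpK κ)ᵒᵖ ⥤ Type u) (C : CmpK κ) :
    (reflection hκ F ⟶ C) ≃ (F ⟶ yoneda.obj C) where
  toFun f := reflectionUnit hκ F ≫ yoneda.map f
  invFun η := ObjectProperty.homMk ⟨_, isMorphism_lift hκ η⟩
  left_inv f := by
    refine ObjectProperty.hom_ext _ (Cmp.Hom.ext (funext fun y => ?_))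
    induction y using Quotient.inductionOn with | _ y
    change onPoints hκ (reflectionUnit hκ F ≫ yoneda.map f) y = _
    rw [onPoints_comp, onPoints_reflectionUnit]
    rfl
  right_inv η := by
    refine eq_of_onPoints_eq hκ ?_
    rw [onPoints_comp, onPoints_reflectionUnit]
    rfl

end Presheaf

/-- The left adjoint of the Yoneda embedding. -/
def reflector : ((CmpK κ)ᵒᵖ ⥤ Type u) ⥤ CmpK κ :=
  Adjunction.leftAdjointOfEquiv (reflectionHomEquiv hκ) fun _ _ _ _ _ => by
    simp [reflectionHomEquiv]

/-- The category of `κ`-compactological sets is total. -/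
def reflectorAdjunction : reflector hκ ⊣ (yoneda : CmpK κ ⥤ _) :=
  Adjunction.adjunctionOfEquivLeft (reflectionHomEquiv hκ) _

lemma reflectorAdjunction_unit_app (F : (CmpK κ)ᵒᵖ ⥤ Type u) :
    (reflectorAdjunction hκ).unit.app F = reflectionUnit hκ F := by
  refine (Adjunction.adjunctionOfEquivLeft_unit_app _ _ F).trans ?_
  exact (congrArg (reflectionUnit hκ F ≫ ·) (yoneda.map_id _)).trans (Category.comp_id _)

lemma isWeakHausdorffReflection_unit (F : (CmpK κ)ᵒᵖ ⥤ Type u) :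
    IsWeakHausdorffReflection (finalTopology hκ F) (reflection hκ F).obj.str.topology
      (onPoints hκ (reflectionUnit hκ F)) := by
  rw [onPoints_reflectionUnit, topology_reflection]
  exact WeakHausdorffQuotient.isWeakHausdorffReflection (X := Points hκ F)

lemma mem_sets_reflection_iff (F : (CmpK κ)ᵒᵖ ⥤ Type u) (A : Set (reflection hκ F).obj) :
    A ∈ (reflection hκ F).obj.str.sets ↔
      ∃ 𝒜 : Set (Set (reflection hκ F).obj), 𝒜.Finite ∧ A = ⋃₀ 𝒜 ∧
        ∀ B ∈ 𝒜, ∃ (C : CmpK κ) (φ : F.obj (op C)), ∃ K ∈ C.obj.str.sets,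
          B = (fun x => onPoints hκ (reflectionUnit hκ F) (evalPt hκ F φ x)) '' K := by
  rw [onPoints_reflectionUnit]
  exact Iff.rfl

end CmpK

/-! ### Limits and colimits from a left adjoint of the Yoneda embedding -/

namespace CategoryTheory

open Limits

universe u'

variable {𝒞 : Type u'} [Category.{u} 𝒞] {J : Type w} [Category.{v} J]

lemma exists_universal_arrow {L : (𝒞ᵒᵖ ⥤ Type u) ⥤ 𝒞} (adj : L ⊣ yoneda) (F : 𝒞ᵒᵖ ⥤ Type u) :
    ∃ (R : 𝒞) (η : F ⟶ yoneda.obj R), ∀ C : 𝒞,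
      Function.Bijective fun f : R ⟶ C => η ≫ yoneda.map f := by
  refine ⟨L.obj F, adj.unit.app F, fun C => ?_⟩
  have : (fun f : L.obj F ⟶ C => adj.unit.app F ≫ yoneda.map f) = adj.homEquiv F C :=
    funext fun f => (adj.homEquiv_unit (f := f)).symm
  exact this ▸ (adj.homEquiv F C).bijective

section Limit

variable (D : J ⥤ 𝒞) [∀ C : 𝒞, Small.{u} ((Functor.const J).obj C ⟶ D)]

/-- The presheaf of small sets of cones over `D`. -/
noncomputable def conesPresheaf : 𝒞ᵒᵖ ⥤ Type u where
  obj C := Shrink.{u} ((Functor.const J).obj C.unop ⟶ D)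
  map f := ↾fun α => equivShrink _ ((Functor.const J).map f.unop ≫ (equivShrink _).symm α)

/-- The projection of `conesPresheaf D` to `D.obj j`. -/
noncomputable def conesPresheafπ (j : J) : conesPresheaf D ⟶ yoneda.obj (D.obj j) where
  app _ := ↾fun α => ((equivShrink _).symm α).app j
  naturality _ _ f := by
    refine ConcreteCategory.hom_ext _ _ fun α => ?_
    exact congrArg (NatTrans.app · j) (Equiv.symm_apply_apply _ _)

lemma conesPresheafπ_naturality {i j : J} (f : i ⟶ j) :
    conesPresheafπ D i ≫ yoneda.map (D.map f) = conesPresheafπ D j := by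
  ext C α
  simpa [conesPresheafπ] using (((equivShrink _).symm α).naturality f).symm

lemma conesPresheaf_hom_ext {G : 𝒞ᵒᵖ ⥤ Type u} {α β : G ⟶ conesPresheaf D}
    (h : ∀ j, α ≫ conesPresheafπ D j = β ≫ conesPresheafπ D j) : α = β := by
  ext C x
  refine (equivShrink _).symm.injective (NatTrans.ext (funext fun j => ?_))
  exact ConcreteCategory.congr_hom (NatTrans.congr_app (h j) C) x

/-- If the Yoneda embedding has a left adjoint, then a functor whose cones with a given vertex
form a small set has a limit. -/
theorem hasLimit_of_small_cones {L : (𝒞ᵒᵖ ⥤ Type u) ⥤ 𝒞} (adj : L ⊣ yoneda) : HasLimit D := by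
  obtain ⟨R, η, hη⟩ := exists_universal_arrow adj (conesPresheaf D)
  choose p hp using fun j => (hη (D.obj j)).2 (conesPresheafπ D j)
  replace hp (j : J) : η ≫ yoneda.map (p j) = conesPresheafπ D j := hp j
  let c : Cone D :=
    { pt := R
      π :=
        { app := p
          naturality := fun i j f => by
            refine (Category.id_comp _).trans ((hη _).1 ?_)
            change η ≫ yoneda.map (p j) = η ≫ yoneda.map (p i ≫ D.map f)
            rw [Functor.map_comp, ← Category.assoc, hp, hp, conesPresheafπ_naturality] } }
  let x : (conesPresheaf D).obj (op R) := equivShrink _ c.π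
  -- The cone `c` on `R` is an element of the cone presheaf, so by Yoneda it gives a candidate
  -- inverse `ρ` of `η`.
  obtain ⟨ρ, hρx⟩ := yonedaEquiv.surjective x
  have hρ (j : J) : ρ ≫ conesPresheafπ D j = yoneda.map (p j) := by
    refine yonedaEquiv.injective ?_
    rw [yonedaEquiv_comp, hρx, yonedaEquiv_yoneda_map]
    exact congrArg (NatTrans.app · j) (Equiv.symm_apply_apply _ _)
  have hηρ : η ≫ ρ = 𝟙 _ := conesPresheaf_hom_ext D fun j => by
    rw [Category.assoc, hρ, hp, Category.id_comp]
  have hρη : ρ ≫ η = 𝟙 _ := by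
    -- By fullness the composite comes from some `e : R ⟶ R`; since `η ≫ ρ` is the identity, `e`
    -- fixes `η`, so universality forces `e = 𝟙 R`.
    obtain ⟨e, he⟩ := yoneda.map_surjective (ρ ≫ η)
    have : e = 𝟙 _ := (hη R).1 (by
      change η ≫ yoneda.map e = η ≫ yoneda.map (𝟙 R)
      rw [he, reassoc_of% hηρ, yoneda.map_id, Category.comp_id])
    rw [← he, this, yoneda.map_id]
  refine ⟨⟨c, ⟨fun s => η.app (op s.pt) (equivShrink _ s.π), fun s j => ?_, fun s m hm => ?_⟩⟩⟩
  · refine (ConcreteCategory.congr_hom (NatTrans.congr_app (hp j) (op s.pt))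
      (equivShrink _ s.π)).trans ?_
    exact congrArg (NatTrans.app · j) (Equiv.symm_apply_apply _ _)
  · refine (ConcreteCategory.congr_hom (NatTrans.congr_app hρη (op s.pt)) m).symm.trans ?_
    refine congrArg (η.app (op s.pt)) ?_
    refine (equivShrink _).symm.injective (NatTrans.ext (funext fun j => ?_))
    refine (ConcreteCategory.congr_hom (NatTrans.congr_app (hρ j) (op s.pt)) m).trans ?_
    refine (hm j).trans ?_
    rw [Equiv.symm_apply_apply]

end Limit

/-- Cones with vertex `C` correspond to morphisms `C ⟶ limit D`, and hom-sets are small. -/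
lemma small_cones_of_hasLimit (D : J ⥤ 𝒞) [HasLimit D] (C : 𝒞) :
    Small.{u} ((Functor.const J).obj C ⟶ D) :=
  ⟨C ⟶ limit D, ⟨((limit.isLimit D).homEquiv (W := C)).symm⟩⟩

section Colimit

variable (D : J ⥤ 𝒞) [∀ C : 𝒞, Small.{u} (ConnectedComponents (StructuredArrow C D))]

/-- The colimit of `D ⋙ yoneda`, as a presheaf of small sets. -/
noncomputable def componentsPresheaf : 𝒞ᵒᵖ ⥤ Type u where
  obj C := Shrink.{u} (ConnectedComponents (StructuredArrow C.unop D))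
  map f := ↾fun x => equivShrink _
    ((StructuredArrow.map f.unop).mapConnectedComponents ((equivShrink _).symm x))
  map_id C := by
    refine ConcreteCategory.hom_ext _ _ fun x => ?_
    obtain ⟨x, rfl⟩ := (equivShrink _).surjective x
    refine congrArg (equivShrink _) ?_
    rw [Equiv.symm_apply_apply]
    induction x using Quotient.inductionOn with | _ x
    exact congrArg (_root_.Quotient.mk _) StructuredArrow.map_id
  map_comp f g := by
    refine ConcreteCategory.hom_ext _ _ fun x => ?_
    obtain ⟨x, rfl⟩ := (equivShrink _).surjective x
    refine congrArg (equivShrink _) ?_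
    refine Eq.trans ?_ (congrArg _ (Equiv.symm_apply_apply _ _).symm)
    rw [Equiv.symm_apply_apply]
    induction x using Quotient.inductionOn with | _ x
    exact congrArg (_root_.Quotient.mk _) StructuredArrow.map_comp

/-- The class of a morphism `C ⟶ D.obj j`. -/
noncomputable def componentsPresheafMk {C : 𝒞} {j : J} (f : C ⟶ D.obj j) :
    (componentsPresheaf D).obj (op C) :=
  equivShrink _ (ConnectedComponents.mk (StructuredArrow.mk f))

lemma componentsPresheaf_exists_mk {C : 𝒞ᵒᵖ} (x : (componentsPresheaf D).obj C) :
    ∃ (j : J) (f : C.unop ⟶ D.obj j), x = componentsPresheafMk D f := by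
  obtain ⟨x, rfl⟩ := (equivShrink _).surjective x
  obtain ⟨x, rfl⟩ := Quotient.exists_rep x
  exact ⟨x.right, x.hom, rfl⟩

lemma componentsPresheaf_map_mk {C C' : 𝒞} {j : J} (g : C' ⟶ C) (f : C ⟶ D.obj j) :
    (componentsPresheaf D).map g.op (componentsPresheafMk D f) =
      componentsPresheafMk D (g ≫ f) := by
  refine congrArg (equivShrink _) ?_
  rw [componentsPresheafMk, Equiv.symm_apply_apply]
  rfl

/-- The arrow `g` is a morphism of the comma category joining the two objects. This provides the
cocone condition. -/
lemma componentsPresheafMk_comp {C : 𝒞} {i j : J} (f : C ⟶ D.obj i) (g : i ⟶ j) :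
    componentsPresheafMk D (f ≫ D.map g) = componentsPresheafMk D f :=
  congrArg (equivShrink _) (_root_.Quotient.sound
    (Zigzag.of_inv (StructuredArrow.homMk g : StructuredArrow.mk f ⟶ StructuredArrow.mk _)))

/-- The components of `componentsPresheafDesc`. -/
noncomputable def componentsPresheafDescFun (s : Cocone D) {C : 𝒞}
    (x : (componentsPresheaf D).obj (op C)) : C ⟶ s.pt :=
  ((equivShrink _).symm x).lift (fun f => f.hom ≫ s.ι.app f.right) fun f g h => by
    change Zigzag f g at h
    induction h with
    | refl => rfl
    | tail _ h ih =>
      refine ih.trans ?_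
      rcases h with ⟨⟨e⟩⟩ | ⟨⟨e⟩⟩
      · rw [← StructuredArrow.w e, Category.assoc, s.w]
      · rw [← StructuredArrow.w e, Category.assoc, s.w]

lemma componentsPresheafDescFun_mk (s : Cocone D) {C : 𝒞} {j : J} (f : C ⟶ D.obj j) :
    componentsPresheafDescFun D s (componentsPresheafMk D f) = f ≫ s.ι.app j := by
  rw [componentsPresheafDescFun, componentsPresheafMk, Equiv.symm_apply_apply]
  rfl

/-- The morphism out of `componentsPresheaf D` given by a cocone. -/
noncomputable def componentsPresheafDesc (s : Cocone D) :
    componentsPresheaf D ⟶ yoneda.obj s.pt where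
  app C := ↾fun x => componentsPresheafDescFun D s x
  naturality C C' f := by
    refine ConcreteCategory.hom_ext _ _ fun x => ?_
    obtain ⟨j, g, rfl⟩ := componentsPresheaf_exists_mk D x
    refine (congrArg (componentsPresheafDescFun D s) (componentsPresheaf_map_mk D f.unop g)).trans ?_
    refine (componentsPresheafDescFun_mk D s _).trans ((Category.assoc _ _ _).trans ?_)
    exact congrArg (f.unop ≫ ·) (componentsPresheafDescFun_mk D s g).symm

lemma componentsPresheafDesc_mk (s : Cocone D) {C : 𝒞} {j : J} (f : C ⟶ D.obj j) :
    (componentsPresheafDesc D s).app (op C) (componentsPresheafMk D f) = f ≫ s.ι.app j :=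
  componentsPresheafDescFun_mk D s f

/-- If the Yoneda embedding has a left adjoint, then a functor `D` such that the colimit of
`D ⋙ yoneda` is a presheaf of small sets has a colimit. -/
theorem hasColimit_of_small_connectedComponents {L : (𝒞ᵒᵖ ⥤ Type u) ⥤ 𝒞} (adj : L ⊣ yoneda) :
    HasColimit D := by
  obtain ⟨R, η, hη⟩ := exists_universal_arrow adj (componentsPresheaf D)
  -- The image under `η` of the class of the identity, as in the Yoneda lemma.
  let ι (j : J) : D.obj j ⟶ R := η.app (op (D.obj j)) (componentsPresheafMk D (𝟙 _))
  have hι {C : 𝒞} {j : J} (f : C ⟶ D.obj j) :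
      f ≫ ι j = η.app (op C) (componentsPresheafMk D f) := by
    refine (NatTrans.naturality_apply η f.op (componentsPresheafMk D (𝟙 (D.obj j)))).symm.trans ?_
    rw [componentsPresheaf_map_mk, Category.comp_id]
  let c : Cocone D :=
    { pt := R
      ι :=
        { app := ι
          naturality := fun i j f => by
            refine Eq.trans ?_ (Category.comp_id _).symm
            rw [hι, ← Category.id_comp (D.map f), componentsPresheafMk_comp] } }
  choose d hd using fun s : Cocone D => (hη s.pt).2 (componentsPresheafDesc D s)
  refine ⟨⟨c, ⟨d, fun s j => ?_, fun s m hm => (hη s.pt).1 (Eq.trans ?_ (hd s).symm)⟩⟩⟩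
  · refine (ConcreteCategory.congr_hom (NatTrans.congr_app (hd s) (op (D.obj j)))
      (componentsPresheafMk D (𝟙 _))).trans ?_
    exact (componentsPresheafDesc_mk D s _).trans (Category.id_comp _)
  · refine NatTrans.ext (funext fun C => ConcreteCategory.hom_ext _ _ fun x => ?_)
    obtain ⟨j, f, rfl⟩ := componentsPresheaf_exists_mk D x
    refine Eq.trans ?_ (componentsPresheafDesc_mk D s f).symm
    rw [← hm j]
    refine Eq.trans ?_ (Category.assoc _ _ _)
    exact congrArg (· ≫ m) (hι f).symm

end Colimit

end CategoryTheory

/-- Totality of `Cmp_κ`, with the explicit description of the left adjoint of the Yoneda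
embedding, and the resulting existence of small and large limits and colimits. -/
theorem mainTheorem8 (κ : Cardinal.{u + 1}) (hκ : Cardinal.aleph0 < κ) (hκs : κ.IsStrongLimit) :
    (∃ (L : ((CmpK κ)ᵒᵖ ⥤ Type u) ⥤ CmpK κ) (adj : L ⊣ yoneda),
      ∀ F : (CmpK κ)ᵒᵖ ⥤ Type u,
        IsWeakHausdorffReflection (CmpK.finalTopology hκ F) (L.obj F).obj.str.topology
          (CmpK.onPoints hκ (adj.unit.app F)) ∧
        ∀ A : Set (L.obj F).obj, A ∈ (L.obj F).obj.str.sets ↔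
          ∃ 𝒜 : Set (Set (L.obj F).obj), 𝒜.Finite ∧ A = ⋃₀ 𝒜 ∧
            ∀ B ∈ 𝒜, ∃ (C : CmpK κ) (φ : F.obj (op C)), ∃ K ∈ C.obj.str.sets,
              B = (fun x => CmpK.onPoints hκ (adj.unit.app F) (CmpK.evalPt hκ F φ x)) '' K) ∧
    Limits.HasLimits (CmpK κ) ∧
    Limits.HasColimits (CmpK κ) ∧
    (∀ (J : Type w) [Category.{v} J] (D : J ⥤ CmpK κ),
      Limits.HasLimit D ↔ ∀ C : CmpK κ, Small.{u} ((Functor.const J).obj C ⟶ D)) ∧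
    (∀ (J : Type w) [Category.{v} J] (D : J ⥤ CmpK κ),
      (∀ C : CmpK κ, Small.{u} (CategoryTheory.ConnectedComponents (StructuredArrow C D))) →
        Limits.HasColimit D) := by
  have adj := CmpK.reflectorAdjunction hκ
  refine ⟨⟨CmpK.reflector hκ, CmpK.reflectorAdjunction hκ, fun F => ?_⟩,
    -- For small `J` the smallness conditions on cones and components hold by universe level, via
    -- instances.
    ⟨fun J _ => ⟨fun D => hasLimit_of_small_cones D adj⟩⟩,
    ⟨fun J _ => ⟨fun D => hasColimit_of_small_connectedComponents D adj⟩⟩,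
    fun J _ D => ⟨fun _ => small_cones_of_hasLimit D, fun _ => hasLimit_of_small_cones D adj⟩,
    fun J _ D _ => hasColimit_of_small_connectedComponents D adj⟩
  rw [CmpK.reflectorAdjunction_unit_app]
  exact ⟨CmpK.isWeakHausdorffReflection_unit hκ F, CmpK.mem_sets_reflection_iff hκ F⟩
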